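/- All $C^*$-algebras are unital. A \emph{system} $\Sigma=(A,G,\alpha,\sigma)$ consists of a $C^*$-algebra $A$, a discrete group $G$ with identity $e$, a map $\alpha:G\to\mathrm{Aut}(A)$ and a map $\sigma:G\times G\to\mathcal U(A)$ such that $\alpha_g\alpha_h=\mathrm{Ad}(\sigma(g,h))\,\alpha_{gh}$, $\sigma(g,h)\sigma(gh,k)=\alpha_g(\sigma(h,k))\,\sigma(g,hk)$ and $\sigma(g,e)=\sigma(e,g)=1_A$ for all $g,h,k\in G$. Two systems $(A,G,\alpha,\sigma)$ and $(B,G,\beta,\theta)$ are \emph{conjugate} if there is a $*$-isomorphism $\phi:A\to B$ with $\beta_g=\phi\circ\alpha_g\circ\phi^{-1}$ and $\theta(g,h)=\phi(\sigma(g,h))$ for all $g,h\in G$. An \emph{$A$-$B$ imprimitivity bimodule} is an $A$-$B$-bimodule $Z$ that is a full right Hilbert $B$-module with inner product $\langle\cdot,\cdot\rangle_B$ on which $A$ acts by adjointable operators through a unital $*$-homomorphism, and a full left Hilbert $A$-module with inner product ${}_A\langle\cdot,\cdot\rangle$ on which $B$ likewise acts by adjointable operators (so that ${}_A\langle z\cdot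 b,z'\rangle={}_A\langle z,z'\cdot b^*\rangle$), such that ${}_A\langle z,z'\rangle\cdot z''=z\cdot\langle z',z''\rangle_B$ for all $z,z',z''\in Z$. Systems $\Sigma=(A,G,\alpha,\sigma)$ and $\Theta=(B,G,\beta,\theta)$ over the same group are \emph{Morita equivalent} if there are an $A$-$B$ imprimitivity bimodule $Z$ and a map $\delta$ from $G$ into the group of invertible bounded $\mathbb C$-linear maps of $Z$ such that, for all $g,h\in G$, $a\in A$, $b\in B$ and $z,\zeta\in Z$: $\delta(g)(a\cdot z)=\alpha_g(a)\cdot\delta(g)z$, $\ \delta(g)(z\cdot b)=(\delta(g)z)\cdot\beta_g(b)$, $\ \delta(g)\delta(h)z=\sigma(g,h)\cdot(\delta(gh)z)\cdot\theta(g,h)^*$ and $\langle\delta(g)z,\delta(g)\zeta\rangle_B=\beta_g(\langle z,\zeta\rangle_B)$. \textbf{Proposition.} Suppose that $\Sigma=(A,G,\alpha,\sigma)$ and $\Theta=(B,G,\beta,\theta)$ are Morita equivalent systems over the same group $G$, and that $A$ and $B$ are commutative. Then there is a $*$-isomorphism $\phi:A\to B$ with $\phi\circ\alpha_g=\beta_g\circ\phi$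 for all $g\in G$. Moreover, with $\sigma_\phi(g,h):=\phi(\sigma(g,h))$ and $\theta_{\phi^{-1}}(g,h):=\phi^{-1}(\theta(g,h))$, the quadruples $(B,G,\beta,\sigma_\phi)$ and $(A,G,\alpha,\theta_{\phi^{-1}})$ are systems, $\Sigma$ is conjugate to $(B,G,\beta,\sigma_\phi)$, and $\Theta$ is conjugate to $(A,G,\alpha,\theta_{\phi^{-1}})$. -/

import Mathlib

open scoped MulOpposite

/-- A twisted action `(α, σ)` of the discrete group `G` on the unital C⋆-algebra `A`; together with
`A` and `G` it forms a twisted unital discrete C⋆-dynamical system `(A, G, α, σ)`. -/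
@[ext]
structure TwistedSystem (A G : Type*) [CStarAlgebra A] [Group G] where
  /-- the automorphisms `α_g` of `A` -/
  act : G → (A ≃⋆ₐ[ℂ] A)
  /-- the 2-cocycle `σ`, with values in the unitary group of `A` -/
  cocycle : G → G → unitary A
  /-- `α_g α_h = Ad(σ(g, h)) α_{gh}` -/
  act_act : ∀ (g h : G) (a : A),
    act g (act h a) = (cocycle g h : A) * act (g * h) a * star (cocycle g h : A)
  /-- `σ(g, h) σ(gh, k) = α_g(σ(h, k)) σ(g, hk)` -/
  cocycle_mul : ∀ g h k : G,
    (cocycle g h : A) * (cocycle (g * h) k : A)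
      = act g (cocycle h k : A) * (cocycle g (h * k) : A)
  cocycle_one_right : ∀ g : G, cocycle g 1 = 1
  cocycle_one_left : ∀ g : G, cocycle 1 g = 1

/-- Conjugacy of two systems over the same group: an isomorphism `φ : A → B` with
`β_g = φ α_g φ⁻¹` and `θ(g, h) = φ(σ(g, h))`. -/
def TwistedSystem.Conjugate {A B G : Type*} [CStarAlgebra A] [CStarAlgebra B] [Group G]
    (S : TwistedSystem A G) (T : TwistedSystem B G) : Prop :=
  ∃ φ : A ≃⋆ₐ[ℂ] B,
    (∀ (g : G) (b : B), T.act g b = φ (S.act g (φ.symm b))) ∧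
    (∀ g h : G, (T.cocycle g h : B) = φ (S.cocycle g h : A))

/-- A Hilbert C⋆-module structure on the complex vector space `Z`: Mathlib's `CStarModule`
(bundled with the norm that it induces), with respect to whose norm `Z` is complete.

The scalars of a `CStarModule` are written on the left, with
`inner x (a • y) = a * inner x y`. So a left Hilbert `A`-module is a `HilbertModule A Z`, with
`A`-valued inner product `leftInner`, and a right Hilbert `B`-module is a
`HilbertModule Bᵐᵒᵖ Z`, with `B`-valued inner product `rightInner`. -/
structure HilbertModule (A Z : Type*) [Ring A] [StarRing A] [Module ℂ A] [PartialOrder A]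
    [Norm A] [AddCommGroup Z] [Module ℂ Z] [Module A Z] where
  [toNorm : Norm Z]
  [toCStarModule : CStarModule A Z]
  complete : ∀ u : ℕ → Z,
    (∀ ε > (0 : ℝ), ∃ N, ∀ m ≥ N, ∀ n ≥ N, ‖u m - u n‖ < ε) →
    ∃ z : Z, Filter.Tendsto (fun n => ‖u n - z‖) Filter.atTop (nhds 0)

namespace HilbertModule

section left

variable {A Z : Type*} [CStarAlgebra A] [PartialOrder A] [AddCommGroup Z] [Module ℂ Z]
  [Module A Z] (X : HilbertModule A Z)

/-- The inner product of a left Hilbert `A`-module; it is `A`-linear in the first variable. -/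
def leftInner (x y : Z) : A := X.toCStarModule.inner y x

theorem leftInner_add_left (x x' y : Z) :
    X.leftInner (x + x') y = X.leftInner x y + X.leftInner x' y :=
  X.toCStarModule.inner_add_right

theorem leftInner_smul_left (a : A) (x y : Z) :
    X.leftInner (a • x) y = a * X.leftInner x y :=
  X.toCStarModule.inner_op_smul_right

theorem leftInner_complex_smul_left (c : ℂ) (x y : Z) :
    X.leftInner (c • x) y = c • X.leftInner x y :=
  X.toCStarModule.inner_smul_right_complex

theorem star_leftInner (x y : Z) : star (X.leftInner x y) = X.leftInner y x :=
  X.toCStarModule.star_inner y x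

theorem leftInner_self_nonneg (x : Z) : 0 ≤ X.leftInner x x :=
  X.toCStarModule.inner_self_nonneg

theorem leftInner_self (x : Z) : X.leftInner x x = 0 ↔ x = 0 :=
  X.toCStarModule.inner_self

/-- Fullness: the linear span of the inner products is dense in `A`. -/
def LeftFull : Prop :=
  Dense (Submodule.span ℂ (Set.range fun p : Z × Z => X.leftInner p.1 p.2) : Set A)

end left

section right

variable {B Z : Type*} [CStarAlgebra B] [PartialOrder B] [AddCommGroup Z] [Module ℂ Z]
  [Module Bᵐᵒᵖ Z] (X : HilbertModule Bᵐᵒᵖ Z)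

/-- The inner product of a right Hilbert `B`-module; it is `B`-linear in the second variable. -/
def rightInner (x y : Z) : B := MulOpposite.unop (X.toCStarModule.inner x y)

theorem rightInner_add_right (x y y' : Z) :
    X.rightInner x (y + y') = X.rightInner x y + X.rightInner x y' :=
  congrArg MulOpposite.unop X.toCStarModule.inner_add_right

theorem rightInner_smul_right (x y : Z) (b : B) :
    X.rightInner x (MulOpposite.op b • y) = X.rightInner x y * b :=
  congrArg MulOpposite.unop X.toCStarModule.inner_op_smul_right

theorem rightInner_complex_smul_right (c : ℂ) (x y : Z) :
    X.rightInner x (c • y) = c • X.rightInner x y :=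
  congrArg MulOpposite.unop X.toCStarModule.inner_smul_right_complex

theorem star_rightInner (x y : Z) : star (X.rightInner x y) = X.rightInner y x :=
  congrArg MulOpposite.unop (X.toCStarModule.star_inner x y)

theorem rightInner_self_nonneg (x : Z) : 0 ≤ X.rightInner x x :=
  X.toCStarModule.inner_self_nonneg

theorem rightInner_self (x : Z) : X.rightInner x x = 0 ↔ x = 0 :=
  (MulOpposite.unop_eq_zero_iff _).trans X.toCStarModule.inner_self

/-- The Hilbert module norm of a right Hilbert `B`-module. -/
noncomputable def rightNorm (x : Z) : ℝ := √‖X.rightInner x x‖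

/-- Fullness: the linear span of the inner products is dense in `B`. -/
def RightFull : Prop :=
  Dense (Submodule.span ℂ (Set.range fun p : Z × Z => X.rightInner p.1 p.2) : Set B)

end right

end HilbertModule

/-- An `A`-`B` imprimitivity bimodule structure on `Z`: a full right Hilbert `A`-`B`-bimodule that
is also a full left Hilbert `A`-`B`-bimodule, the two inner products being linked by
`_A⟨x, y⟩ · z = x · ⟨y, z⟩_B`. The right action `z · b` is `MulOpposite.op b • z`.
The norms of the two Hilbert modules are not assumed to agree. -/
structure ImprimitivityBimodule (A B Z : Type*) [CStarAlgebra A] [PartialOrder A]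
    [CStarAlgebra B] [PartialOrder B] [AddCommGroup Z] [Module ℂ Z] [Module A Z]
    [Module Bᵐᵒᵖ Z] where
  /-- the left Hilbert `A`-module -/
  left : HilbertModule A Z
  /-- the right Hilbert `B`-module -/
  right : HilbertModule Bᵐᵒᵖ Z
  /-- `A` acts by adjointable operators on the right Hilbert `B`-module, as a ⋆-homomorphism. -/
  right_adjoint : ∀ (a : A) (x y : Z),
    right.rightInner (a • x) y = right.rightInner x (star a • y)
  /-- `B` acts by adjointable operators on the left Hilbert `A`-module, `⋆`-preservingly. -/
  left_adjoint : ∀ (b : B) (x y : Z),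
    left.leftInner (MulOpposite.op b • x) y
      = left.leftInner x (MulOpposite.op (star b) • y)
  left_full : left.LeftFull
  right_full : right.RightFull
  /-- `_A⟨x, y⟩ · z = x · ⟨y, z⟩_B` -/
  inner_compat : ∀ x y z : Z,
    left.leftInner x y • z = MulOpposite.op (right.rightInner y z) • x

/-- A `(Σ, Θ)`-compatible action of `G` on a right Hilbert `A`-`B`-bimodule `Z`, by invertible
bounded `ℂ`-linear maps. -/
structure CompatibleAction {A B G Z : Type*} [CStarAlgebra A] [CStarAlgebra B] [PartialOrder B]
    [Group G] [AddCommGroup Z] [Module ℂ Z] [Module A Z] [Module Bᵐᵒᵖ Z]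
    (S : TwistedSystem A G) (T : TwistedSystem B G) (X : HilbertModule Bᵐᵒᵖ Z) where
  /-- the invertible linear maps `δ(g)` -/
  map : G → (Z ≃ₗ[ℂ] Z)
  bounded : ∀ g : G, ∃ C : ℝ, ∀ z : Z, X.rightNorm (map g z) ≤ C * X.rightNorm z
  /-- `δ(g)(a · z) = α_g(a) · δ(g)z` -/
  map_smul_left : ∀ (g : G) (a : A) (z : Z), map g (a • z) = S.act g a • map g z
  /-- `δ(g)(z · b) = δ(g)z · β_g(b)` -/
  map_smul_right : ∀ (g : G) (z : Z) (b : B),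
    map g (MulOpposite.op b • z) = MulOpposite.op (T.act g b) • map g z
  /-- `δ(g) δ(h) z = σ(g, h) · δ(gh)z · θ(g, h)⋆` -/
  map_map : ∀ (g h : G) (z : Z),
    map g (map h z)
      = MulOpposite.op (star (T.cocycle g h : B)) • ((S.cocycle g h : A) • map (g * h) z)
  /-- `⟨δ(g)z, δ(g)ζ⟩_B = β_g(⟨z, ζ⟩_B)` -/
  inner_map : ∀ (g : G) (z ζ : Z),
    X.rightInner (map g z) (map g ζ) = T.act g (X.rightInner z ζ)

universe u v w z

/-- Morita equivalence of two systems over the same group: there are an `A`-`B` imprimitivity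
bimodule `Z` and a compatible action of `G` on it. -/
def TwistedSystem.MoritaEquivalent {A : Type u} {B : Type v} {G : Type w}
    [CStarAlgebra A] [PartialOrder A] [CStarAlgebra B] [PartialOrder B] [Group G]
    (S : TwistedSystem A G) (T : TwistedSystem B G) : Prop :=
  ∃ (Z : Type z) (_ : AddCommGroup Z) (_ : Module ℂ Z) (_ : Module A Z) (_ : Module Bᵐᵒᵖ Z)
    (X : ImprimitivityBimodule A B Z), Nonempty (CompatibleAction S T X.right)

/-! Each `a : A` acts on `Z` as right multiplication by a unique `φ a : B`. Indeed the `c : B` for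
which `z ↦ a · z · c` is right multiplication by an element of `B` form an ideal; by the link
between the inner products and commutativity it contains every `⟨x, y⟩_B`, so by fullness it
contains `1`. Symmetry and faithfulness of both actions make `φ` a ⋆-isomorphism
(`exists_starAlgEquiv`). Equivariance is read off from the two covariance identities of `δ(g)`, and
the cocycles are then carried along `φ`. -/

/-- In a unital Banach algebra the closure of a proper ideal is still proper. -/
theorem Ideal.eq_top_of_span_dense {R : Type*} [CommCStarAlgebra R] (I : Ideal R) {s : Set R}
    (hs : Dense (Submodule.span ℂ s : Set R)) (hI : s ⊆ I) : I = ⊤ := by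
  by_contra h
  refine Ideal.closure_ne_top I h ?_
  have hle : Submodule.span ℂ s ≤ I.restrictScalars ℂ := Submodule.span_le.2 hI
  refine (Ideal.eq_top_iff_one _).2 ?_
  exact closure_mono (show (Submodule.span ℂ s : Set R) ⊆ I from hle) (hs 1)

namespace HilbertModule

section left

variable {A Z : Type*} [CStarAlgebra A] [PartialOrder A] [AddCommGroup Z] [Module ℂ Z]
  [Module A Z]

theorem leftInner_sub_left (X : HilbertModule A Z) (x x' y : Z) :
    X.leftInner (x - x') y = X.leftInner x y - X.leftInner x' y := by
  have h := X.leftInner_add_left (x - x') x' y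
  rw [sub_add_cancel] at h
  exact eq_sub_of_add_eq h.symm

theorem eq_of_leftInner (X : HilbertModule A Z) {x x' : Z}
    (h : ∀ y, X.leftInner x y = X.leftInner x' y) : x = x' := by
  rw [← sub_eq_zero, ← X.leftInner_self, X.leftInner_sub_left, h, sub_self]

/-- Compatibility of the two scalar actions comes from nondegeneracy of the inner product; it gives
the `ℂ`-linearity of `φ`. -/
theorem complex_smul_smul (X : HilbertModule A Z) (c : ℂ) (a : A) (z : Z) :
    (c • a) • z = c • a • z :=
  X.eq_of_leftInner fun y => by
    simp only [X.leftInner_smul_left, X.leftInner_complex_smul_left, smul_mul_assoc]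

end left

section right

variable {B Z : Type*} [CStarAlgebra B] [PartialOrder B] [AddCommGroup Z] [Module ℂ Z]
  [Module Bᵐᵒᵖ Z]

theorem rightInner_sub_right (X : HilbertModule Bᵐᵒᵖ Z) (x y y' : Z) :
    X.rightInner x (y - y') = X.rightInner x y - X.rightInner x y' := by
  have h := X.rightInner_add_right x (y - y') y'
  rw [sub_add_cancel] at h
  exact eq_sub_of_add_eq h.symm

theorem eq_of_rightInner (X : HilbertModule Bᵐᵒᵖ Z) {y y' : Z}
    (h : ∀ x, X.rightInner x y = X.rightInner x y') : y = y' := by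
  rw [← sub_eq_zero, ← X.rightInner_self, X.rightInner_sub_right, h, sub_self]

theorem complex_smul_op_smul (X : HilbertModule Bᵐᵒᵖ Z) (c : ℂ) (b : B) (z : Z) :
    MulOpposite.op (c • b) • z = c • MulOpposite.op b • z :=
  X.eq_of_rightInner fun y => by
    simp only [X.rightInner_smul_right, X.rightInner_complex_smul_right, mul_smul_comm]

theorem rightInner_smul_left (X : HilbertModule Bᵐᵒᵖ Z) (x y : Z) (b : B) :
    X.rightInner (MulOpposite.op b • x) y = star b * X.rightInner x y := by
  rw [← X.star_rightInner, X.rightInner_smul_right, star_mul, X.star_rightInner]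

end right

end HilbertModule

namespace ImprimitivityBimodule

variable {A B Z : Type*} [CommCStarAlgebra A] [PartialOrder A] [CommCStarAlgebra B]
  [PartialOrder B] [AddCommGroup Z] [Module ℂ Z] [Module A Z] [Module Bᵐᵒᵖ Z]

theorem left_ideal_eq_top (X : ImprimitivityBimodule A B Z) (I : Ideal A)
    (hI : ∀ x y, X.left.leftInner x y ∈ I) : I = ⊤ :=
  I.eq_top_of_span_dense X.left_full (Set.range_subset_iff.2 fun p => hI p.1 p.2)

theorem right_ideal_eq_top (X : ImprimitivityBimodule A B Z) (I : Ideal B)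
    (hI : ∀ x y, X.right.rightInner x y ∈ I) : I = ⊤ :=
  I.eq_top_of_span_dense X.right_full (Set.range_subset_iff.2 fun p => hI p.1 p.2)

/-- The annihilator of `a - a'` is an ideal containing all inner products. -/
theorem eq_of_smul (X : ImprimitivityBimodule A B Z)
    {a a' : A} (h : ∀ z : Z, a • z = a' • z) : a = a' := by
  have hI := X.left_ideal_eq_top (LinearMap.ker (LinearMap.mulLeft A (a - a'))) fun x y => by
    rw [LinearMap.mem_ker, LinearMap.mulLeft_apply, ← X.left.leftInner_smul_left, sub_smul, h,
      sub_self, ← sub_self x, X.left.leftInner_sub_left, sub_self]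
  have h1 : (1 : A) ∈ LinearMap.ker (LinearMap.mulLeft A (a - a')) := hI ▸ Submodule.mem_top
  simpa [sub_eq_zero] using h1

theorem eq_of_op_smul (X : ImprimitivityBimodule A B Z) {b b' : B}
    (h : ∀ z : Z, MulOpposite.op b • z = MulOpposite.op b' • z) : b = b' := by
  have hI := X.right_ideal_eq_top (LinearMap.ker (LinearMap.mulLeft B (b - b'))) fun x y => by
    rw [LinearMap.mem_ker, LinearMap.mulLeft_apply, mul_comm, mul_sub,
      ← X.right.rightInner_smul_right, ← X.right.rightInner_smul_right, h, sub_self]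
  have h1 : (1 : B) ∈ LinearMap.ker (LinearMap.mulLeft B (b - b')) := hI ▸ Submodule.mem_top
  simpa [sub_eq_zero] using h1

/-- Adjointability forces this: `⟨y, a(zb)⟩ = ⟨a⋆y, z⟩b = ⟨y, (az)b⟩`. -/
theorem smul_op_smul (X : ImprimitivityBimodule A B Z) (a : A) (b : B) (z : Z) :
    a • MulOpposite.op b • z = MulOpposite.op b • a • z :=
  X.right.eq_of_rightInner fun y => by
    rw [X.right.rightInner_smul_right, ← star_star a, ← X.right_adjoint,
      X.right.rightInner_smul_right, X.right_adjoint]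

theorem exists_op_smul_eq_smul (X : ImprimitivityBimodule A B Z) (a : A) :
    ∃ b : B, ∀ z : Z, a • z = MulOpposite.op b • z := by
  let I : Ideal B :=
    { carrier := {c | ∃ b : B, ∀ z : Z, MulOpposite.op c • a • z = MulOpposite.op b • z}
      zero_mem' := ⟨0, fun z => by simp⟩
      add_mem' := by
        rintro c c' ⟨b, hb⟩ ⟨b', hb'⟩
        exact ⟨b + b', fun z => by simp only [MulOpposite.op_add, add_smul, hb, hb']⟩
      smul_mem' := by
        rintro d c ⟨b, hb⟩
        refine ⟨b * d, fun z => ?_⟩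
        rw [smul_eq_mul, mul_comm, MulOpposite.op_mul, MulOpposite.op_mul, mul_smul, mul_smul, hb] }
  -- `a · z · ⟨x, y⟩_B = a · _A⟨z, x⟩ · y = _A⟨z, x⟩ · a · y = z · ⟨x, a · y⟩_B`, using that `A` is
  -- commutative.
  have hI : I = ⊤ := X.right_ideal_eq_top I fun x y => ⟨X.right.rightInner x (a • y), fun z => by
    rw [← X.smul_op_smul, ← X.inner_compat, ← X.inner_compat, smul_smul, smul_smul, mul_comm]⟩
  obtain ⟨b, hb⟩ : (1 : B) ∈ I := hI ▸ Submodule.mem_top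
  exact ⟨b, fun z => by simpa using hb z⟩

theorem exists_smul_eq_op_smul (X : ImprimitivityBimodule A B Z) (b : B) :
    ∃ a : A, ∀ z : Z, a • z = MulOpposite.op b • z := by
  let I : Ideal A :=
    { carrier := {c | ∃ a : A, ∀ z : Z, c • MulOpposite.op b • z = a • z}
      zero_mem' := ⟨0, fun z => by simp⟩
      add_mem' := by
        rintro c c' ⟨a, ha⟩ ⟨a', ha'⟩
        exact ⟨a + a', fun z => by simp only [add_smul, ha, ha']⟩
      smul_mem' := by
        rintro d c ⟨a, ha⟩
        exact ⟨d * a, fun z => by rw [smul_eq_mul, mul_smul, mul_smul, ha]⟩ }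
  -- The mirror computation; here commutativity of `B` is what matters.
  have hI : I = ⊤ := X.left_ideal_eq_top I fun x y =>
    ⟨X.left.leftInner (MulOpposite.op b • x) y, fun z => by
      rw [X.smul_op_smul, X.inner_compat, X.inner_compat, smul_smul, smul_smul,
        ← MulOpposite.op_mul, ← MulOpposite.op_mul, mul_comm]⟩
  obtain ⟨a, ha⟩ : (1 : A) ∈ I := hI ▸ Submodule.mem_top
  exact ⟨a, fun z => by simpa using (ha z).symm⟩

/-- An imprimitivity bimodule over commutative C⋆-algebras identifies them, in such a way that the
left and the right actions agree. -/
theorem exists_starAlgEquiv (X : ImprimitivityBimodule A B Z) :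
    ∃ φ : A ≃⋆ₐ[ℂ] B, ∀ (a : A) (z : Z), a • z = MulOpposite.op (φ a) • z := by
  choose f hf using X.exists_op_smul_eq_smul
  choose k hk using X.exists_smul_eq_op_smul
  refine ⟨{ toFun := f
            invFun := k
            left_inv := fun a => X.eq_of_smul fun z => by rw [hk, hf]
            right_inv := fun b => X.eq_of_op_smul fun z => by rw [← hf, hk]
            map_mul' := fun a a' => X.eq_of_op_smul fun z => by
              rw [← hf, mul_comm, MulOpposite.op_mul, mul_smul, mul_smul, ← hf, ← hf]
            map_add' := fun a a' => X.eq_of_op_smul fun z => by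
              rw [← hf, MulOpposite.op_add, add_smul, add_smul, ← hf, ← hf]
            -- `⟨y, a⋆z⟩ = ⟨ay, z⟩ = (φ a)⋆⟨y, z⟩`, and in `B` the factors commute.
            map_star' := fun a => X.eq_of_op_smul fun z => X.right.eq_of_rightInner fun y => by
              rw [← hf, ← X.right_adjoint, hf, X.right.rightInner_smul_left,
                X.right.rightInner_smul_right, mul_comm]
            map_smul' := fun c a => X.eq_of_op_smul fun z => by
              rw [← hf, X.left.complex_smul_smul, X.right.complex_smul_op_smul, ← hf] }, hf⟩

end ImprimitivityBimodule

/-- The system obtained from `S` by carrying the cocycle along an isomorphism that intertwines the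
actions. -/
def TwistedSystem.transport {A B G : Type*} [CStarAlgebra A] [CStarAlgebra B] [Group G]
    (S : TwistedSystem A G) (β : G → (B ≃⋆ₐ[ℂ] B)) (φ : A ≃⋆ₐ[ℂ] B)
    (hφ : ∀ (g : G) (a : A), φ (S.act g a) = β g (φ a)) : TwistedSystem B G where
  act := β
  cocycle g h := ⟨φ (S.cocycle g h : A), Unitary.map_mem φ (S.cocycle g h).2⟩
  act_act g h b := by
    obtain ⟨a, rfl⟩ := EquivLike.surjective φ b
    simp only [← hφ, S.act_act, map_mul, map_star]
  cocycle_mul g h k := by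
    have := congrArg φ (S.cocycle_mul g h k)
    rwa [map_mul, map_mul, hφ] at this
  cocycle_one_right g := by simp [S.cocycle_one_right]
  cocycle_one_left g := by simp [S.cocycle_one_left]

theorem TwistedSystem.conjugate_transport {A B G : Type*} [CStarAlgebra A] [CStarAlgebra B]
    [Group G] (S : TwistedSystem A G) (β : G → (B ≃⋆ₐ[ℂ] B)) (φ : A ≃⋆ₐ[ℂ] B)
    (hφ : ∀ (g : G) (a : A), φ (S.act g a) = β g (φ a)) :
    S.Conjugate (S.transport β φ hφ) :=
  ⟨φ, fun g b => by rw [hφ, StarAlgEquiv.apply_symm_apply]; rfl, fun _ _ => rfl⟩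

theorem mainTheorem6 {A : Type u} {B : Type v} {G : Type w}
    [CommCStarAlgebra A] [PartialOrder A] [StarOrderedRing A]
    [CommCStarAlgebra B] [PartialOrder B] [StarOrderedRing B] [Group G]
    (S : TwistedSystem A G) (T : TwistedSystem B G)
    (hST : TwistedSystem.MoritaEquivalent.{u, v, w, z} S T) :
    ∃ φ : A ≃⋆ₐ[ℂ] B,
      (∀ (g : G) (a : A), φ (S.act g a) = T.act g (φ a)) ∧
      (∃ S' : TwistedSystem B G,
        S'.act = T.act ∧
        (∀ g h : G, (S'.cocycle g h : B) = φ (S.cocycle g h : A)) ∧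
        S.Conjugate S') ∧
      (∃ T' : TwistedSystem A G,
        T'.act = S.act ∧
        (∀ g h : G, (T'.cocycle g h : A) = φ.symm (T.cocycle g h : B)) ∧
        T.Conjugate T') := by
  obtain ⟨Z, _, _, _, _, X, ⟨δ⟩⟩ := hST
  obtain ⟨φ, hφ⟩ := X.exists_starAlgEquiv
  have hφS : ∀ (g : G) (a : A), φ (S.act g a) = T.act g (φ a) := fun g a =>
    X.eq_of_op_smul fun z => by
      -- On vectors `δ(g)z`, both sides equal `δ(g)(a · z) = δ(g)(z · φ a)`.
      obtain ⟨z, rfl⟩ := (δ.map g).surjective z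
      rw [← hφ, ← δ.map_smul_left, hφ, δ.map_smul_right]
  have hφT : ∀ (g : G) (b : B), φ.symm (T.act g b) = S.act g (φ.symm b) := fun g b =>
    EquivLike.injective φ (by rw [hφS, StarAlgEquiv.apply_symm_apply, StarAlgEquiv.apply_symm_apply])
  exact ⟨φ, hφS,
    ⟨S.transport T.act φ hφS, rfl, fun _ _ => rfl, S.conjugate_transport T.act φ hφS⟩,
    ⟨T.transport S.act φ.symm hφT, rfl, fun _ _ => rfl,
      T.conjugate_transport S.act φ.symm hφT⟩⟩
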